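/- Let $m\ge 1$ and let $\mathbb R_m$ be the real Clifford algebra with generators $e_1,\dots,e_m$, $e_j^2=-1$, $e_ie_j=-e_je_i$ ($i\ne j$). Identify $x\in\mathbb R^m$ with $x=\sum_j x_je_j\in\mathbb R_m$, so that $x^2=-|x|^2$, and let $\partial_x=\sum_{j=1}^m e_j\,\partial_{x_j}$ be the Dirac operator acting from the left on functions $\mathbb R^m\to\mathbb R_m$. Let $k\ge 0$ and let $Y_k\ne 0$ be an $\mathbb R_m$-valued homogeneous polynomial on $\mathbb R^m$ of degree $k$ with $\partial_xY_k=0$ (for instance, a member $Y_k^i$ of an orthonormal basis of the space $M_l^+(k)$ of all such polynomials). For $n\ge 0$ let $$C_{n,m}^0(Y_k)=D_0D_1\cdots D_{n-1}Y_k,\qquad D_\alpha f(x)=(1-|x|^2)^{-\alpha}\,\partial_x\big((1-|x|^2)^{\alpha+1}f(x)\big),$$ be the Clifford–Legendre polynomials; that is, $C_{n,m}^0(Y_k)=\partial_x^n\big((1-|x|^2)^nY_k\big)$, a polynomial on $\mathbb R^m$; in particular $C_{0,m}^0(Y_k)=Y_k$. **Theorem.** For every $n\ge 0$ there are exactly $\lfloor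 n/2\rfloor$ radii $r>0$ such that $C_{n,m}^0(Y_k)$ vanishes identically on the sphere $\{|x|=r\}$, and all of them are less than $1$; write them as $$0<r_{n,1}<r_{n,2}<\cdots<r_{n,\lfloor n/2\rfloor}<1 .$$ The zero set of $C_{n,m}^0(Y_k)$ is the union of these spheres and the zero set of $Y_k$, together with the origin if $n$ is odd. The radii interlace as $n$ varies: for every $N\ge 0$, $$r_{2N+2,1}<r_{2N,1}<r_{2N+1,1}<r_{2N+2,2}<r_{2N,2}<r_{2N+1,2}<\cdots<r_{2N+2,N}<r_{2N,N}<r_{2N+1,N}<r_{2N+2,N+1}$$ and $$r_{2N+2,1}<r_{2N+3,1}<r_{2N+1,1}<r_{2N+2,2}<r_{2N+3,2}<r_{2N+1,2}<\cdots<r_{2N+2,N}<r_{2N+3,N}<r_{2N+1,N}<r_{2N+2,N+1}<r_{2N+3,N+1}.$$ In particular, the radii of any two consecutive polynomials interlace strictly, and so do those of two consecutive polynomials of even index and of two consecutive polynomials of odd index. -/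

import Mathlib

noncomputable section

namespace CliffordLegendre

/-- Euclidean space `ℝ^m`. -/
abbrev Euc (m : ℕ) : Type := EuclideanSpace ℝ (Fin m)

/-- The quadratic form `x ↦ -|x|²` on `ℝ^m`. -/
def negSq (m : ℕ) : QuadraticForm ℝ (Euc m) :=
  -(LinearMap.BilinMap.toQuadraticMap (innerₗ (Euc m)))

theorem negSq_apply (m : ℕ) (x : Euc m) : negSq m x = -‖x‖ ^ 2 := by
  simp [negSq]

/-- The real Clifford algebra `ℝ_m`, in which `e_j ^ 2 = -1` and `e_i e_j = - e_j e_i`. -/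
abbrev Cl (m : ℕ) : Type := CliffordAlgebra (negSq m)

/-- The embedding of `ℝ^m` in `ℝ_m` as the space of Clifford vectors,
`x ↦ ∑ j, x_j e_j`. -/
def vec {m : ℕ} (x : Euc m) : Cl m := CliffordAlgebra.ι (negSq m) x

/-- The generator `e_j` of `ℝ_m`. -/
def e {m : ℕ} (j : Fin m) : Cl m := vec (EuclideanSpace.single j (1 : ℝ))

theorem vec_mul_self {m : ℕ} (x : Euc m) :
    vec x * vec x = algebraMap ℝ (Cl m) (-‖x‖ ^ 2) := by
  rw [vec, CliffordAlgebra.ι_sq_scalar, negSq_apply]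

/-- A basis of the `2^m`-dimensional space `ℝ_m`, indexed by the subsets of `{1, …, m}`. -/
def bladeBasis (m : ℕ) : Module.Basis (Finset (Fin m)) ℝ (Cl m) :=
  ((EuclideanSpace.basisFun (Fin m) ℝ).toBasis.ExteriorAlgebra).map
    (CliffordAlgebra.equivExterior (negSq m)).symm

/-- The coordinates of a Clifford number. -/
def coord (m : ℕ) : Cl m ≃ₗ[ℝ] EuclideanSpace ℝ (Finset (Fin m)) :=
  (bladeBasis m).equivFun.trans (WithLp.linearEquiv 2 ℝ (Finset (Fin m) → ℝ)).symm

/-- The Euclidean norm of the coordinates.  The space `ℝ_m` is finite-dimensional, so all norms on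
it are equivalent; the norm only serves to give a meaning to derivatives of `ℝ_m`-valued
functions. -/
instance instNormedAddCommGroupCl (m : ℕ) : NormedAddCommGroup (Cl m) :=
  NormedAddCommGroup.induced (Cl m) (EuclideanSpace ℝ (Finset (Fin m))) (coord m)
    (coord m).injective

instance instNormedSpaceCl (m : ℕ) : NormedSpace ℝ (Cl m) :=
  NormedSpace.induced ℝ (Cl m) (EuclideanSpace ℝ (Finset (Fin m))) (coord m)

/-- The Dirac operator `∂_x f = ∑ j, e_j ∂f/∂x_j`, acting from the left. -/
def dirac {m : ℕ} (f : Euc m → Cl m) (x : Euc m) : Cl m :=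
  ∑ j : Fin m, e j * lineDeriv ℝ f x (EuclideanSpace.single j (1 : ℝ))

/-- `f` is an `ℝ_m`-valued homogeneous polynomial of degree `k`, that is
`f x = ∑_{|d| = k} x^d c_d` with Clifford coefficients `c_d`. -/
def IsHomogeneousPolynomial {m : ℕ} (k : ℕ) (f : Euc m → Cl m) : Prop :=
  ∃ c : (Fin m → ℕ) → Cl m, ∀ x : Euc m,
    f x = ∑ d ∈ Finset.piAntidiag (Finset.univ : Finset (Fin m)) k, (∏ i, x i ^ d i) • c d

/-- The space `M_l^+(k)` of left solid inner spherical monogenics of order `k`: left monogenic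
homogeneous polynomials of degree `k`. -/
def IsInnerSphericalMonogenic {m : ℕ} (k : ℕ) (Y : Euc m → Cl m) : Prop :=
  IsHomogeneousPolynomial k Y ∧ ∀ x : Euc m, dirac Y x = 0

/-- The operator `D_α f = (1 + x²)^{-α} ∂_x ((1 + x²)^{α + 1} f)`, where `x² = -|x|²`. -/
def gegenbauerOp {m : ℕ} (α : ℝ) (f : Euc m → Cl m) (x : Euc m) : Cl m :=
  (1 - ‖x‖ ^ 2) ^ (-α) • dirac (fun y => (1 - ‖y‖ ^ 2) ^ (α + 1) • f y) x

/-- The Clifford–Gegenbauer polynomial `C_{n,m}^α(Y) = D_α D_{α+1} ⋯ D_{α+n-1} Y`. -/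
def gegenbauer {m : ℕ} : ℝ → ℕ → (Euc m → Cl m) → Euc m → Cl m
  | _, 0, Y => Y
  | α, n + 1, Y => gegenbauerOp α (gegenbauer (α + 1) n Y)

/-- The Clifford–Legendre polynomial `C_{n,m}^0(Y)`. -/
def legendre {m : ℕ} (n : ℕ) (Y : Euc m → Cl m) : Euc m → Cl m := gegenbauer 0 n Y

/-- The radii of the spheres centred at the origin on which `f` vanishes identically. -/
def vanishingRadii {m : ℕ} (f : Euc m → Cl m) : Set ℝ :=
  {r | 0 < r ∧ ∀ x : Euc m, ‖x‖ = r → f x = 0}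

end CliffordLegendre

end

noncomputable section

namespace CliffordLegendre

open Polynomial Finset

/-! Put `s = k + m/2` and `t = |x|²`. The Dirac operator sends `p(t) Y` to `2p'(t) x Y` and `p(t) x
Y` to `-2(t p'(t) + s p(t)) Y`. Applied `n` times to `(1 - t)^n Y`, it gives, up to a nonzero
constant, `P_N(t) Y` if `n = 2N` and `Q_N(t) x Y` if `n = 2N + 1`, where `P_N = jacobi s N` and `Q_N
= jacobi (s + 1) N` (`legendre_eq_radial`, `radialIter_even`, `radialIter_odd`). So the squared
radii are the zeros of `P_N` and `Q_N`.

Interlacing comes from `P_{N+1} = P_N - c t Q_N` and `Q_{N+1} = a P_{N+1} + b Q_N` with `a, b, c >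
0` (`jacobi_succ`, `jacobi_add_one_succ`). By induction on `N`, the signs at the known zeros and at
`0` and `1` locate `N + 1` zeros of each new polynomial in `(0, 1)`; the degree leaves room for no
others (`InterlacingRoots.exists_succ`). -/

/-- The coefficients of the hypergeometric polynomial `₂F₁(-N, N + s; s; t)`. -/
def jacobiCoeff (s : ℝ) (N i : ℕ) : ℝ :=
  ∏ l ∈ range i, (((l : ℝ) - N) * (l + N + s) / ((l + 1) * (l + s)))

/-- The hypergeometric polynomial `₂F₁(-N, N + s; s; t)`, a shifted Jacobi polynomial, orthogonal
on `[0, 1]` for the weight `t ^ (s - 1)`. -/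
def jacobi (s : ℝ) (N : ℕ) : ℝ[X] :=
  ∑ i ∈ range (N + 1), monomial i (jacobiCoeff s N i)

/-! ### Coefficients and contiguous relations of the hypergeometric polynomials. -/

theorem jacobiCoeff_zero (s : ℝ) (N : ℕ) : jacobiCoeff s N 0 = 1 := by simp [jacobiCoeff]

theorem jacobiCoeff_succ (s : ℝ) (N i : ℕ) : jacobiCoeff s N (i + 1) =
    jacobiCoeff s N i * (((i : ℝ) - N) * (i + N + s) / ((i + 1) * (i + s))) := by
  rw [jacobiCoeff, prod_range_succ, jacobiCoeff]

theorem jacobiCoeff_eq_zero (s : ℝ) {N i : ℕ} (h : N < i) : jacobiCoeff s N i = 0 :=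
  prod_eq_zero (mem_range.2 h) (by simp)

theorem coeff_jacobi (s : ℝ) (N i : ℕ) : (jacobi s N).coeff i = jacobiCoeff s N i := by
  simp only [jacobi, finsetSum_coeff, coeff_monomial, sum_ite_eq', mem_range]
  split_ifs with h
  · rfl
  · exact (jacobiCoeff_eq_zero s (by omega)).symm

theorem natDegree_jacobi_le (s : ℝ) (N : ℕ) : (jacobi s N).natDegree ≤ N :=
  natDegree_le_iff_coeff_eq_zero.2 fun i hi => by
    rw [coeff_jacobi, jacobiCoeff_eq_zero s hi]

theorem eval_zero_jacobi (s : ℝ) (N : ℕ) : (jacobi s N).eval 0 = 1 := by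
  rw [← coeff_zero_eq_eval_zero, coeff_jacobi, jacobiCoeff_zero]

theorem jacobi_zero (s : ℝ) : jacobi s 0 = 1 := by
  simp [jacobi, jacobiCoeff_zero]

/-- This and the next two lemmas refer everything to `jacobiCoeff (s + 1) N i`, so that the
contiguous relations reduce to identities of rational functions. -/
theorem jacobiCoeff_succ_succ {s : ℝ} (hs : 0 < s) (N i : ℕ) :
    jacobiCoeff s (N + 1) (i + 1) =
      jacobiCoeff (s + 1) N i * (-(N + 1) * (N + s + 1 + i) / (s * (i + 1))) := by
  induction i with
  | zero =>
    simp only [jacobiCoeff_succ, jacobiCoeff_zero]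
    push_cast
    field_simp
    ring
  | succ i ih =>
    have h : (i : ℝ) + 1 + s ≠ 0 := by positivity
    rw [jacobiCoeff_succ, ih, jacobiCoeff_succ (s + 1)]
    push_cast
    field_simp
    ring

theorem jacobiCoeff_succ_eq {s : ℝ} (hs : 0 < s) (N i : ℕ) :
    jacobiCoeff s N (i + 1) =
      jacobiCoeff (s + 1) N i * ((i - N) * (N + s) / (s * (i + 1))) := by
  induction i with
  | zero =>
    simp only [jacobiCoeff_succ, jacobiCoeff_zero]
    push_cast
    field_simp
    ring
  | succ i ih =>
    have h : (i : ℝ) + 1 + s ≠ 0 := by positivity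
    rw [jacobiCoeff_succ, ih, jacobiCoeff_succ (s + 1)]
    push_cast
    field_simp
    ring

theorem jacobiCoeff_add_one_succ_succ {s : ℝ} (hs : 0 < s) (N i : ℕ) :
    jacobiCoeff (s + 1) (N + 1) (i + 1) =
      jacobiCoeff (s + 1) N i * (-(N + 1) * (i + N + s + 2) * (i + N + s + 1) /
        ((N + s + 1) * (i + 1) * (i + s + 1))) := by
  induction i with
  | zero =>
    simp only [jacobiCoeff_succ, jacobiCoeff_zero]
    push_cast
    field_simp
    ring
  | succ i ih =>
    have h : (i : ℝ) + 1 + s ≠ 0 := by positivity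
    rw [jacobiCoeff_succ, ih, jacobiCoeff_succ (s + 1) N]
    push_cast
    field_simp
    ring

theorem jacobi_succ {s : ℝ} (hs : 0 < s) (N : ℕ) :
    jacobi s (N + 1) = jacobi s N - C ((2 * N + s + 1) / s) * (X * jacobi (s + 1) N) := by
  ext i
  cases i with
  | zero => simp [coeff_jacobi, jacobiCoeff_zero]
  | succ i =>
    rw [coeff_sub, coeff_C_mul, coeff_X_mul, coeff_jacobi, coeff_jacobi, coeff_jacobi,
      jacobiCoeff_succ_succ hs, jacobiCoeff_succ_eq hs]
    field_simp
    ring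

theorem jacobi_add_one_succ {s : ℝ} (hs : 0 < s) (N : ℕ) :
    jacobi (s + 1) (N + 1) =
      C (s * (2 * N + s + 2) / (N + s + 1) ^ 2) * jacobi s (N + 1) +
        C ((N + 1) ^ 2 / (N + s + 1) ^ 2) * jacobi (s + 1) N := by
  ext i
  rw [coeff_add, coeff_C_mul, coeff_C_mul, coeff_jacobi, coeff_jacobi, coeff_jacobi]
  cases i with
  | zero =>
    simp only [jacobiCoeff_zero]
    field_simp
    ring
  | succ i =>
    rw [jacobiCoeff_succ_succ hs, jacobiCoeff_add_one_succ_succ hs, jacobiCoeff_succ]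
    have h : (i : ℝ) + s + 1 ≠ 0 := by positivity
    have h' : (i : ℝ) + (s + 1) ≠ 0 := by positivity
    field_simp
    ring

/-- The two claims need a joint induction: the ratio of the values at `1` turns `jacobi_succ` into
`P_{N+1}(1) = -(N+1)/(s+N) P_N(1)`, whence the alternating sign. -/
theorem eval_one_jacobi_add_one {s : ℝ} (hs : 0 < s) (N : ℕ) :
    (s + N) * (jacobi (s + 1) N).eval 1 = s * (jacobi s N).eval 1 ∧
      0 < (-1) ^ N * (jacobi s N).eval 1 := by
  induction N with
  | zero => simp [jacobi_zero]
  | succ N ih =>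
    obtain ⟨h1, h2⟩ := ih
    have hq : (jacobi (s + 1) N).eval 1 = s * (jacobi s N).eval 1 / (s + N) := by
      rw [← h1]
      field_simp
    have hp : (jacobi s (N + 1)).eval 1 = -((N + 1) / (s + N)) * (jacobi s N).eval 1 := by
      rw [jacobi_succ hs]
      simp only [eval_sub, eval_mul, eval_C, eval_X, hq]
      field_simp
      ring
    constructor
    · rw [jacobi_add_one_succ hs]
      simp only [eval_add, eval_mul, eval_C, hq, hp]
      push_cast
      field_simp
      ring
    · rw [hp, pow_succ]
      have : 0 < ((N : ℝ) + 1) / (s + N) * ((-1) ^ N * (jacobi s N).eval 1) := by positivity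
      linarith

/-! ### The radial factor of the iterated Dirac operator. -/

/-- The action of the Dirac operator on the radial factor of `p(|x|²) Y`. -/
def evenStep (p : ℝ[X]) : ℝ[X] := C 2 * derivative p

/-- The action of the Dirac operator on the radial factor of `p(|x|²) x Y`. -/
def oddStep (s : ℝ) (p : ℝ[X]) : ℝ[X] := C (-2) * (X * derivative p + C s * p)

/-- The action of the `n`-th power of the Dirac operator on the radial factor of `p(|x|²) Y`. -/
def radialIter (s : ℝ) : ℕ → ℝ[X] → ℝ[X]
  | 0, p => p
  | n + 1, p => if Even n then evenStep (radialIter s n p) else oddStep s (radialIter s n p)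

theorem coeff_evenStep (p : ℝ[X]) (i : ℕ) :
    (evenStep p).coeff i = 2 * (i + 1) * p.coeff (i + 1) := by
  rw [evenStep, coeff_C_mul, coeff_derivative]
  ring

theorem coeff_oddStep (s : ℝ) (p : ℝ[X]) (i : ℕ) :
    (oddStep s p).coeff i = -2 * (i + s) * p.coeff i := by
  rw [oddStep, coeff_C_mul, coeff_add, coeff_C_mul]
  cases i with
  | zero =>
    simp
    ring
  | succ i =>
    rw [coeff_X_mul, coeff_derivative]
    push_cast
    ring

theorem radialIter_two_mul_succ (s : ℝ) (N : ℕ) (p : ℝ[X]) :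
    radialIter s (2 * (N + 1)) p = oddStep s (evenStep (radialIter s (2 * N) p)) := by
  rw [show 2 * (N + 1) = 2 * N + 1 + 1 by ring]
  simp [radialIter]

theorem radialIter_two_mul_add_one (s : ℝ) (N : ℕ) (p : ℝ[X]) :
    radialIter s (2 * N + 1) p = evenStep (radialIter s (2 * N) p) := by
  simp [radialIter]

theorem coeff_radialIter_two_mul (s : ℝ) (N : ℕ) (p : ℝ[X]) (i : ℕ) :
    (radialIter s (2 * N) p).coeff i =
      (-4) ^ N * (∏ l ∈ range N, ((i : ℝ) + l + 1) * (i + l + s)) * p.coeff (i + N) := by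
  induction N generalizing i with
  | zero => simp [radialIter]
  | succ N ih =>
    -- The new pair of steps contributes `-4(i+1)(i+s)`, the factor at `l = 0`; the induction
    -- hypothesis, taken at `i + 1`, supplies the others.
    rw [radialIter_two_mul_succ, coeff_oddStep, coeff_evenStep, ih, prod_range_succ',
      show i + 1 + N = i + (N + 1) by ring]
    have : ∀ l : ℕ, ((i + 1 : ℕ) : ℝ) + l + 1 = i + (l + 1 : ℕ) + 1 ∧
        ((i + 1 : ℕ) : ℝ) + l + s = i + (l + 1 : ℕ) + s := fun l => by
      push_cast
      constructor <;> ring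
    simp only [this]
    push_cast
    ring

theorem coeff_one_sub_X_pow_succ (n j : ℕ) :
    ((j : ℝ) + 1) * ((1 - X : ℝ[X]) ^ n).coeff (j + 1) =
      (j - n) * ((1 - X : ℝ[X]) ^ n).coeff j := by
  have h : (1 - X : ℝ[X]) * derivative ((1 - X) ^ n) = C (-(n : ℝ)) * (1 - X) ^ n := by
    cases n with
    | zero => simp
    | succ n =>
      rw [derivative_pow_succ]
      simp
      ring
  have h' := congrArg (fun p => p.coeff j) h
  simp only [sub_mul, one_mul, coeff_sub, coeff_C_mul, coeff_derivative] at h'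
  cases j with
  | zero =>
    simp at h' ⊢
    linarith
  | succ j =>
    rw [coeff_X_mul, coeff_derivative] at h'
    push_cast at h' ⊢
    linarith

theorem coeff_one_sub_X_pow_ne_zero {n j : ℕ} (h : j ≤ n) :
    ((1 - X : ℝ[X]) ^ n).coeff j ≠ 0 := by
  induction j with
  | zero => simp [coeff_zero_eq_eval_zero]
  | succ j ih =>
    intro h0
    have := coeff_one_sub_X_pow_succ n j
    rw [h0, mul_zero, zero_eq_mul] at this
    rcases this with h1 | h1
    · rw [sub_eq_zero, Nat.cast_inj] at h1
      omega
    · exact ih (by omega) h1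

theorem eq_smul_jacobi {s : ℝ} (hs : 0 < s) (N : ℕ) (p : ℝ[X])
    (h : ∀ i : ℕ, p.coeff (i + 1) * ((i + 1) * (i + s)) = (i - N) * (i + N + s) * p.coeff i) :
    p = C (p.coeff 0) * jacobi s N := by
  ext i
  rw [coeff_C_mul, coeff_jacobi]
  induction i with
  | zero => simp [jacobiCoeff_zero]
  | succ i ih =>
    rw [jacobiCoeff_succ, ← mul_assoc, ← ih, mul_div_assoc', eq_div_iff (by positivity), h i]
    ring

theorem prod_range_shift_mul {R : Type*} [CommMonoid R] (f : ℕ → R) (N : ℕ) :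
    (∏ l ∈ range N, f (l + 1)) * f 0 = (∏ l ∈ range N, f l) * f N := by
  rw [← prod_range_succ', prod_range_succ]

theorem prod_pochhammer_shift (a b : ℝ) (N : ℕ) :
    (∏ l ∈ range N, (a + 1 + l + 1) * (a + 1 + l + b)) * ((a + 1) * (a + b)) =
      (∏ l ∈ range N, (a + l + 1) * (a + l + b)) * ((a + N + 1) * (a + N + b)) := by
  have := prod_range_shift_mul (fun l : ℕ => (a + l + 1) * (a + l + b)) N
  simp only [Nat.cast_zero, add_zero] at this
  rw [← this]
  congr 1
  refine prod_congr rfl fun l _ => ?_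
  push_cast
  ring

/-- The ratio of consecutive coefficients is `(i+N+1)(i+N+s)/((i+1)(i+s))` from the products times
`(i-N)/(i+N+1)` from `(1 - X)^(2N)`; it is the hypergeometric ratio. In the odd case the extra
derivative replaces `s` by `s + 1`. -/
theorem radialIter_even {s : ℝ} (hs : 0 < s) (N : ℕ) :
    ∃ κ : ℝ, κ ≠ 0 ∧ radialIter s (2 * N) ((1 - X) ^ (2 * N)) = C κ * jacobi s N := by
  refine ⟨_, ?_, eq_smul_jacobi hs N _ fun i => ?_⟩
  · rw [coeff_radialIter_two_mul]
    refine mul_ne_zero (mul_ne_zero (by positivity) ?_) ?_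
    · exact (prod_pos fun l _ => by positivity).ne'
    · exact coeff_one_sub_X_pow_ne_zero (by omega)
  · rw [coeff_radialIter_two_mul, coeff_radialIter_two_mul]
    have h1 := prod_pochhammer_shift i s N
    have h2 := coeff_one_sub_X_pow_succ (2 * N) (i + N)
    rw [show i + 1 + N = i + N + 1 by ring]
    push_cast at h1 h2 ⊢
    generalize (∏ l ∈ range N, ((i : ℝ) + 1 + l + 1) * (i + 1 + l + s)) = E' at *
    generalize (∏ l ∈ range N, ((i : ℝ) + l + 1) * (i + l + s)) = E at *
    linear_combination (-4) ^ N * ((1 - X : ℝ[X]) ^ (2 * N)).coeff (i + N + 1) * h1 +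
      (-4) ^ N * E * (i + N + s) * h2

theorem radialIter_odd {s : ℝ} (hs : 0 < s) (N : ℕ) :
    ∃ κ : ℝ, κ ≠ 0 ∧
      radialIter s (2 * N + 1) ((1 - X) ^ (2 * N + 1)) = C κ * jacobi (s + 1) N := by
  rw [radialIter_two_mul_add_one]
  refine ⟨_, ?_, eq_smul_jacobi (by positivity) N _ fun i => ?_⟩
  · rw [coeff_evenStep, coeff_radialIter_two_mul]
    refine mul_ne_zero (by positivity) (mul_ne_zero (mul_ne_zero (by positivity) ?_) ?_)
    · exact (prod_pos fun l _ => by positivity).ne'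
    · exact coeff_one_sub_X_pow_ne_zero (by omega)
  · rw [coeff_evenStep, coeff_evenStep, coeff_radialIter_two_mul, coeff_radialIter_two_mul]
    have h1 := prod_pochhammer_shift (i + 1) s N
    have h2 := coeff_one_sub_X_pow_succ (2 * N + 1) (i + 1 + N)
    rw [show i + 1 + 1 + N = i + 1 + N + 1 by ring]
    push_cast at h1 h2 ⊢
    generalize (∏ l ∈ range N, ((i : ℝ) + 1 + 1 + l + 1) * (i + 1 + 1 + l + s)) = E' at *
    generalize (∏ l ∈ range N, ((i : ℝ) + 1 + l + 1) * (i + 1 + l + s)) = E at *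
    linear_combination 2 * (i + 1) * (-4) ^ N *
        ((1 - X : ℝ[X]) ^ (2 * N + 1)).coeff (i + 1 + N + 1) * h1 +
      2 * (i + 1) * (-4) ^ N * E * (i + 1 + N + s) * h2

/-- Each step lowers the order of vanishing at `1` by at most one. This settles the unit sphere,
where the weights cannot be divided out. -/
theorem one_sub_X_pow_dvd_radialIter (s : ℝ) (a n : ℕ) (p : ℝ[X])
    (h : (1 - X) ^ (a + n) ∣ p) : (1 - X) ^ a ∣ radialIter s n p := by
  induction n generalizing a with
  | zero => simpa [radialIter] using h
  | succ n ih =>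
    have h1 : (1 - X) ^ (a + 1) ∣ radialIter s n p := ih (a + 1) (by convert h using 2; ring)
    have h2 : (1 - X) ^ a ∣ derivative (radialIter s n p) := by
      have h := pow_sub_one_dvd_derivative_of_pow_dvd h1
      rwa [Nat.add_sub_cancel] at h
    have h3 : (1 - X) ^ a ∣ radialIter s n p := (pow_dvd_pow _ a.le_succ).trans h1
    simp only [radialIter, evenStep, oddStep]
    split_ifs
    · exact h2.mul_left _
    · exact ((h2.mul_left _).add (h3.mul_left _)).mul_left _

/-! ### Locating zeros by sign changes, and their interlacing. -/

theorem neg_one_pow_mul_prod_pos {x : ℕ → ℝ} {N j : ℕ} {t : ℝ} (hj : j ≤ N)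
    (hx : ∀ i < N, 0 < x i) (h1 : ∀ i < j, x i < t) (h2 : ∀ i, j ≤ i → i < N → t < x i) :
    0 < (-1) ^ j * ∏ i ∈ range N, (1 - t / x i) := by
  rw [← prod_range_mul_prod_Ico _ hj, ← mul_assoc]
  refine mul_pos ?_ (prod_pos fun i hi => ?_)
  · rw [← card_range j, ← prod_const, card_range, ← prod_mul_distrib]
    refine prod_pos fun i hi => ?_
    rw [mem_range] at hi
    have := (one_lt_div (hx i (by omega))).2 (h1 i hi)
    linarith
  · rw [mem_Ico] at hi
    exact sub_pos.2 ((div_lt_one (hx i hi.2)).2 (h2 i hi.1 hi.2))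

theorem exists_root_mem_Ioo {p : ℝ[X]} {a b : ℝ} (hab : a < b) {n : ℕ}
    (ha : 0 < (-1) ^ n * p.eval a) (hb : 0 < (-1) ^ (n + 1) * p.eval b) :
    ∃ c ∈ Set.Ioo a b, p.eval c = 0 := by
  have hc : ContinuousOn (fun t => (-1) ^ n * p.eval t) (Set.Icc a b) := by fun_prop
  obtain ⟨c, hc, h⟩ := intermediate_value_Ioo' hab.le hc
    (show (0 : ℝ) ∈ Set.Ioo _ _ from ⟨by rw [pow_succ] at hb; linarith, ha⟩)
  exact ⟨c, hc, by simpa using h⟩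

/-- Both sides have degree at most `N` and agree at `0` and at the `N` roots. The product shows that
no root is missing and gives the signs between roots. -/
theorem eval_eq_prod_of_roots {p : ℝ[X]} {N : ℕ} {x : ℕ → ℝ} (hp : p.natDegree ≤ N)
    (h0 : p.eval 0 = 1) (hpos : ∀ i < N, 0 < x i) (hx : Set.InjOn x (Set.Iio N))
    (hr : ∀ i < N, p.eval (x i) = 0) (t : ℝ) :
    p.eval t = ∏ i ∈ range N, (1 - t / x i) := by
  set q : ℝ[X] := ∏ i ∈ range N, (1 - C (x i)⁻¹ * X) with hq
  have hqe : ∀ t, q.eval t = ∏ i ∈ range N, (1 - t / x i) := fun t => by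
    simp only [hq, eval_prod, eval_sub, eval_one, eval_mul, eval_C, eval_X]
    exact prod_congr rfl fun i _ => by rw [div_eq_inv_mul]
  have hqd : q.natDegree ≤ N := by
    refine (natDegree_prod_le _ _).trans ?_
    refine (sum_le_card_nsmul _ _ 1 fun i _ => ?_).trans (by simp)
    compute_degree
  have hmem : ∀ v ∈ insert 0 ((range N).image x), v = 0 ∨ ∃ i < N, x i = v := by
    simp
  have hcard : #(insert 0 ((range N).image x)) = N + 1 := by
    rw [card_insert_of_notMem, card_image_of_injOn, card_range]
    · simpa using hx
    · simp only [mem_image, mem_range, not_exists, not_and]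
      exact fun i hi => (hpos i hi).ne'
  rw [← hqe, eq_of_degrees_lt_of_eval_finset_eq (insert 0 ((range N).image x)) (f := p) (g := q)]
  · rw [hcard]
    exact (degree_le_of_natDegree_le ‹_›).trans_lt (by exact_mod_cast N.lt_succ_self)
  · rw [hcard]
    exact (degree_le_of_natDegree_le ‹_›).trans_lt (by exact_mod_cast N.lt_succ_self)
  · intro v hv
    rw [hqe]
    rcases hmem v hv with rfl | ⟨i, hi, rfl⟩
    · simp [h0]
    · rw [hr i hi, eq_comm]
      exact prod_eq_zero (mem_range.2 hi) (by rw [div_self (hpos i hi).ne', sub_self])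

/-- `x 0 < y 0 < x 1 < y 1 < ⋯` are the zeros in `(0, 1)` of `jacobi s N` (the `x j`) and of
`jacobi (s + 1) N` (the `y j`). -/
structure InterlacingRoots (s : ℝ) (N : ℕ) (x y : ℕ → ℝ) : Prop where
  pos : ∀ j < N, 0 < x j
  lt : ∀ j < N, x j < y j
  lt_succ : ∀ j, j + 1 < N → y j < x (j + 1)
  lt_one : ∀ j < N, y j < 1
  eval_left : ∀ t, (jacobi s N).eval t = ∏ j ∈ range N, (1 - t / x j)
  eval_right : ∀ t, (jacobi (s + 1) N).eval t = ∏ j ∈ range N, (1 - t / y j)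

theorem lt_of_alternating {N : ℕ} {x y : ℕ → ℝ} (h1 : ∀ j < N, x j < y j)
    (h2 : ∀ j, j + 1 < N → y j < x (j + 1)) {i j : ℕ} (hij : i < j) (hj : j < N) :
    y i < x j := by
  induction j, hij using Nat.le_induction with
  | base => exact h2 i hj
  | succ k hk ih => exact ((ih (by omega)).trans (h1 k (by omega))).trans (h2 k hj)

namespace InterlacingRoots

variable {s : ℝ} {N : ℕ} {x y : ℕ → ℝ}

theorem lt_left (h : InterlacingRoots s N x y) {i j : ℕ} (hij : i < j) (hj : j < N) :
    y i < x j :=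
  lt_of_alternating h.lt h.lt_succ hij hj

theorem pos_right (h : InterlacingRoots s N x y) (j : ℕ) (hj : j < N) : 0 < y j :=
  (h.pos j hj).trans (h.lt j hj)

theorem strictMonoOn_left (h : InterlacingRoots s N x y) : StrictMonoOn x (Set.Iio N) :=
  fun _ hi _ hj hij => (h.lt _ hi).trans (h.lt_left hij hj)

theorem strictMonoOn_right (h : InterlacingRoots s N x y) : StrictMonoOn y (Set.Iio N) :=
  fun _ _ _ hj hij => (h.lt_left hij hj).trans (h.lt _ hj)

theorem eval_left_eq_zero (h : InterlacingRoots s N x y) {j : ℕ} (hj : j < N) :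
    (jacobi s N).eval (x j) = 0 := by
  rw [h.eval_left]
  exact prod_eq_zero (mem_range.2 hj) (by rw [div_self (h.pos j hj).ne', sub_self])

theorem eval_right_eq_zero (h : InterlacingRoots s N x y) {j : ℕ} (hj : j < N) :
    (jacobi (s + 1) N).eval (y j) = 0 := by
  rw [h.eval_right]
  exact prod_eq_zero (mem_range.2 hj) (by rw [div_self (h.pos_right j hj).ne', sub_self])

/-- The lower bound is not strict because the sign is needed at `t = y i` itself; for `j = 0` there
is no lower bound and for `j = N` no upper one. -/
theorem sign_left (h : InterlacingRoots s N x y) {j : ℕ} {t : ℝ} (hj : j ≤ N)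
    (h1 : ∀ i, i + 1 = j → y i ≤ t) (h2 : j < N → t < x j) :
    0 < (-1) ^ j * (jacobi s N).eval t := by
  rw [h.eval_left]
  refine neg_one_pow_mul_prod_pos hj h.pos (fun i hi => ?_) fun i hi hi' => ?_
  · obtain ⟨l, rfl⟩ : ∃ l, j = l + 1 := ⟨j - 1, by omega⟩
    refine lt_of_le_of_lt ?_ ((h.lt l (by omega)).trans_le (h1 l rfl))
    exact h.strictMonoOn_left.monotoneOn (show i < N by omega) (show l < N by omega) (by omega)
  · exact (h2 (by omega)).trans_le
      (h.strictMonoOn_left.monotoneOn (show j < N by omega) (show i < N by omega) hi)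

theorem sign_right (h : InterlacingRoots s N x y) {j : ℕ} {t : ℝ} (hj : j ≤ N)
    (h1 : ∀ i, i + 1 = j → y i < t) (h2 : j < N → t < y j) :
    0 < (-1) ^ j * (jacobi (s + 1) N).eval t := by
  rw [h.eval_right]
  refine neg_one_pow_mul_prod_pos hj h.pos_right (fun i hi => ?_) fun i hi hi' => ?_
  · obtain ⟨l, rfl⟩ : ∃ l, j = l + 1 := ⟨j - 1, by omega⟩
    refine lt_of_le_of_lt ?_ (h1 l rfl)
    exact h.strictMonoOn_right.monotoneOn (show i < N by omega) (show l < N by omega) (by omega)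
  · exact (h2 (by omega)).trans_le
      (h.strictMonoOn_right.monotoneOn (show j < N by omega) (show i < N by omega) hi)

/-- The zero lies in `(y_{j-1}, x_j)`, reading `y_{-1}` as `0` and `x_N` as `1`. In `jacobi_succ`
one term vanishes at each interior endpoint, leaving `P_N(y_{j-1})` and `-c x_j Q_N(x_j)`, of
opposite signs. -/
theorem exists_root_left_succ (hs : 0 < s) (h : InterlacingRoots s N x y) {j : ℕ} (hj : j ≤ N) :
    ∃ z, 0 < z ∧ (∀ i, i + 1 = j → y i < z) ∧ (j < N → z < x j) ∧ z < 1 ∧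
      (jacobi s (N + 1)).eval z = 0 := by
  have hl : ∃ l, 0 ≤ l ∧ (∀ i, i + 1 = j → y i = l) ∧
      -- Yields `l < r` in both cases: from `0 < r` if `j = 0`, from `y i < r` otherwise.
      (∀ r, 0 < r → (∀ i, i + 1 = j → y i < r) → l < r) ∧
      0 < (-1) ^ j * (jacobi s (N + 1)).eval l := by
    cases j with
    | zero =>
      exact ⟨0, le_rfl, by simp, fun r hr _ => hr, by simp [eval_zero_jacobi]⟩
    | succ i =>
      refine ⟨y i, (h.pos_right i hj).le, by simp, fun r _ hr => hr i rfl, ?_⟩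
      rw [jacobi_succ hs]
      simp only [eval_sub, eval_mul, eval_C, eval_X, h.eval_right_eq_zero hj, mul_zero, sub_zero]
      exact h.sign_left hj (by simp) (h.lt_succ i)
  have hr : ∃ r, (∀ i, i + 1 = j → y i < r) ∧ (j < N → r = x j) ∧ 0 < r ∧ r ≤ 1 ∧
      0 < (-1) ^ (j + 1) * (jacobi s (N + 1)).eval r := by
    rcases hj.lt_or_eq with hj | rfl
    · have hy : ∀ i, i + 1 = j → y i < x j := fun i hi => h.lt_left (by omega) hj
      refine ⟨x j, hy, fun _ => rfl, h.pos j hj, ((h.lt j hj).trans (h.lt_one j hj)).le, ?_⟩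
      rw [jacobi_succ hs]
      simp only [eval_sub, eval_mul, eval_C, eval_X, h.eval_left_eq_zero hj, zero_sub]
      have := h.sign_right hj.le hy fun _ => h.lt j hj
      have := mul_pos (mul_pos (show 0 < (2 * (N : ℝ) + s + 1) / s by positivity) (h.pos j hj)) this
      rw [pow_succ]
      linarith
    · exact ⟨1, fun i hi => h.lt_one i (by omega), fun h => (lt_irrefl _ h).elim, one_pos, le_rfl,
        (eval_one_jacobi_add_one hs _).2⟩
  obtain ⟨l, hl0, hl1, hl2, hl4⟩ := hl
  obtain ⟨r, hr0, hr1, hr2, hr3, hr4⟩ := hr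
  have hlr : l < r := hl2 r hr2 hr0
  obtain ⟨z, ⟨hz1, hz2⟩, hz⟩ := exists_root_mem_Ioo hlr hl4 hr4
  refine ⟨z, by linarith, fun i hi => ?_, fun hj => ?_, by linarith, hz⟩
  · rw [hl1 i hi]
    exact hz1
  · rw [← hr1 hj]
    exact hz2

/-- The zero lies in `(z, y_j)`, reading `y_N` as `1`: `Q_{N+1}` equals `b Q_N` at `z`, and at `y_j`
it equals `a P_{N+1} = a P_N`, of the opposite sign. -/
theorem exists_root_right_succ (hs : 0 < s) (h : InterlacingRoots s N x y) {j : ℕ} (hj : j ≤ N)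
    {z : ℝ} (hz1 : ∀ i, i + 1 = j → y i < z) (hz2 : j < N → z < x j) (hz3 : z < 1)
    (hz4 : (jacobi s (N + 1)).eval z = 0) :
    ∃ w, z < w ∧ (j < N → w < y j) ∧ w < 1 ∧ (jacobi (s + 1) (N + 1)).eval w = 0 := by
  have hzy : j < N → z < y j := fun hj => (hz2 hj).trans (h.lt j hj)
  have hl : 0 < (-1) ^ j * (jacobi (s + 1) (N + 1)).eval z := by
    rw [jacobi_add_one_succ hs]
    simp only [eval_add, eval_mul, eval_C, hz4, mul_zero, zero_add]
    rw [mul_left_comm]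
    exact mul_pos (by positivity) (h.sign_right hj hz1 hzy)
  have hr : ∃ r, z < r ∧ (j < N → r = y j) ∧ r ≤ 1 ∧
      0 < (-1) ^ (j + 1) * (jacobi (s + 1) (N + 1)).eval r := by
    rcases hj.lt_or_eq with hj | rfl
    · refine ⟨y j, hzy hj, fun _ => rfl, (h.lt_one j hj).le, ?_⟩
      rw [jacobi_add_one_succ hs]
      simp only [eval_add, eval_mul, eval_C, h.eval_right_eq_zero hj, mul_zero, add_zero]
      rw [mul_left_comm]
      refine mul_pos (by positivity) ?_
      rw [jacobi_succ hs]
      simp only [eval_sub, eval_mul, eval_C, eval_X, h.eval_right_eq_zero hj, mul_zero, sub_zero]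
      exact h.sign_left hj (by simp) (h.lt_succ j)
    · refine ⟨1, hz3, fun h => (lt_irrefl _ h).elim, le_rfl, ?_⟩
      obtain ⟨h1, h2⟩ := eval_one_jacobi_add_one hs (j + 1)
      have h3 : 0 < s + (j + 1 : ℕ) := by positivity
      refine pos_of_mul_pos_right ?_ h3.le
      rw [mul_left_comm, h1, mul_left_comm]
      exact mul_pos hs h2
  obtain ⟨r, hr0, hr1, hr2, hr3⟩ := hr
  obtain ⟨w, ⟨hw1, hw2⟩, hw⟩ := exists_root_mem_Ioo hr0 hl hr3
  refine ⟨w, hw1, fun hj => ?_, by linarith, hw⟩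
  rw [← hr1 hj]
  exact hw2

theorem exists_succ (hs : 0 < s) (h : InterlacingRoots s N x y) :
    ∃ z w, InterlacingRoots s (N + 1) z w ∧
      ∀ j < N, z j < x j ∧ w j < y j ∧ y j < z (j + 1) := by
  choose! z hz using fun j (hj : j ≤ N) => h.exists_root_left_succ hs hj
  choose! w hw using fun j (hj : j ≤ N) =>
    h.exists_root_right_succ hs hj (hz j hj).2.1 (hz j hj).2.2.1 (hz j hj).2.2.2.1
      (hz j hj).2.2.2.2
  have hyz : ∀ j < N, y j < z (j + 1) := fun j hj => (hz (j + 1) hj).2.1 j rfl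
  have hpos : ∀ j < N + 1, 0 < z j := fun j hj => (hz j (by omega)).1
  have hlt : ∀ j < N + 1, z j < w j := fun j hj => (hw j (by omega)).1
  have hlt' : ∀ j, j + 1 < N + 1 → w j < z (j + 1) := fun j hj =>
    ((hw j (by omega)).2.1 (by omega)).trans (hyz j (by omega))
  have hz' : Set.InjOn z (Set.Iio (N + 1)) := StrictMonoOn.injOn fun i hi j hj hij =>
    (hlt i hi).trans (lt_of_alternating hlt hlt' hij hj)
  have hw' : Set.InjOn w (Set.Iio (N + 1)) := StrictMonoOn.injOn fun i hi j hj hij =>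
    (lt_of_alternating hlt hlt' hij hj).trans (hlt j hj)
  refine ⟨z, w, ⟨hpos, hlt, hlt', fun j hj => (hw j (by omega)).2.2.1, ?_, ?_⟩, fun j hj =>
    ⟨(hz j hj.le).2.2.1 hj, (hw j hj.le).2.1 hj, hyz j hj⟩⟩
  · exact eval_eq_prod_of_roots (natDegree_jacobi_le _ _) (eval_zero_jacobi _ _) hpos hz'
      fun j hj => (hz j (by omega)).2.2.2.2
  · exact eval_eq_prod_of_roots (natDegree_jacobi_le _ _) (eval_zero_jacobi _ _)
      (fun j hj => (hpos j hj).trans (hlt j hj)) hw' fun j hj => (hw j (by omega)).2.2.2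

end InterlacingRoots

theorem interlacingRoots_zero (s : ℝ) (x y : ℕ → ℝ) : InterlacingRoots s 0 x y where
  pos := by simp
  lt := by simp
  lt_succ := by simp
  lt_one := by simp
  eval_left := by simp [jacobi_zero]
  eval_right := by simp [jacobi_zero]

theorem exists_interlacingRoots {s : ℝ} (hs : 0 < s) :
    ∃ x y : ℕ → ℕ → ℝ, (∀ N, InterlacingRoots s N (x N) (y N)) ∧
      ∀ N, ∀ j < N, x (N + 1) j < x N j ∧ y (N + 1) j < y N j ∧ y N j < x (N + 1) (j + 1) := by
  choose z w h using fun (N : ℕ) (p : {p : (ℕ → ℝ) × (ℕ → ℝ) // InterlacingRoots s N p.1 p.2}) =>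
    p.2.exists_succ hs
  let f : ∀ N, {p : (ℕ → ℝ) × (ℕ → ℝ) // InterlacingRoots s N p.1 p.2} := fun N =>
    Nat.rec ⟨(0, 0), interlacingRoots_zero s 0 0⟩
      (fun N p => ⟨(z N p, w N p), (h N p).1⟩) N
  exact ⟨fun N => (f N).1.1, fun N => (f N).1.2, fun N => (f N).2, fun N => (h N (f N)).2⟩

/-! ### The Dirac operator on radial multiples of `Y` and `x Y`. -/

section

variable {m : ℕ}

instance (m : ℕ) : FiniteDimensional ℝ (Cl m) := (bladeBasis m).finiteDimensional_of_finite

/-- Multiplication in the Clifford algebra as a continuous bilinear map. -/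
def mulCLM (m : ℕ) : Cl m →L[ℝ] Cl m →L[ℝ] Cl m :=
  (LinearMap.mul ℝ (Cl m)).toContinuousBilinearMap

/-- The embedding of Clifford vectors as a continuous linear map. -/
def vecCLM (m : ℕ) : Euc m →L[ℝ] Cl m := (CliffordAlgebra.ι (negSq m)).toContinuousLinearMap

theorem vecCLM_apply (x : Euc m) : vecCLM m x = vec x := rfl

theorem vec_eq_sum (x : Euc m) : vec x = ∑ j, x j • e j := by
  have h : x = ∑ j, x j • EuclideanSpace.single j (1 : ℝ) := by
    ext i
    simp [Pi.single_apply]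
  conv_lhs => rw [h]
  simp only [← vecCLM_apply, map_sum, map_smul, e]

/-- Clifford numbers may be zero divisors, but nonzero vectors are invertible since `x² = -|x|²`. -/
theorem vec_mul_eq_zero_iff {x : Euc m} {c : Cl m} : vec x * c = 0 ↔ x = 0 ∨ c = 0 := by
  constructor
  · intro h
    have h2 : vec x * (vec x * c) = (-‖x‖ ^ 2) • c := by
      rw [← mul_assoc, vec_mul_self, Algebra.smul_def]
    rw [h, mul_zero, eq_comm, smul_eq_zero] at h2
    simpa using h2
  · rintro (rfl | rfl)
    · simp [vec]
    · simp

theorem e_mul_vec (j : Fin m) (x : Euc m) :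
    e j * vec x = -(vec x * e j) + (-2 * x j) • (1 : Cl m) := by
  have h := CliffordAlgebra.ι_mul_ι_add_swap (Q := negSq m) (EuclideanSpace.single j (1 : ℝ)) x
  have hp : QuadraticMap.polar (negSq m) (EuclideanSpace.single j (1 : ℝ)) x = -2 * x j := by
    rw [QuadraticMap.polar, negSq_apply, negSq_apply, negSq_apply, norm_add_sq_real]
    rw [EuclideanSpace.inner_single_left]
    simp
    ring
  rw [hp, Algebra.algebraMap_eq_smul_one] at h
  rw [← h, e, vec, vec]
  abel

theorem e_mul_e (j : Fin m) : e j * e j = (-1 : Cl m) := by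
  rw [e, vec_mul_self]
  simp

theorem dirac_eq {f : Euc m → Cl m} {f' : Euc m →L[ℝ] Cl m} {x : Euc m}
    (h : HasFDerivAt f f' x) : dirac f x = ∑ j, e j * f' (EuclideanSpace.single j 1) :=
  sum_congr rfl fun j _ => by rw [(h.hasLineDerivAt _).lineDeriv]

theorem hasFDerivAt_eval_norm_sq (p : ℝ[X]) (x : Euc m) :
    HasFDerivAt (fun y : Euc m => p.eval (‖y‖ ^ 2))
      ((derivative p).eval (‖x‖ ^ 2) • (2 : ℝ) • innerSL ℝ x) x := by
  have h : HasFDerivAt (fun y : Euc m => ‖y‖ ^ 2) ((2 : ℝ) • innerSL ℝ x) x := by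
    simpa [ofNat_smul_eq_nsmul] using (hasStrictFDerivAt_norm_sq x).hasFDerivAt
  exact (p.hasDerivAt _).comp_hasFDerivAt x h

theorem dirac_radial_smul (p : ℝ[X]) {f : Euc m → Cl m} {x : Euc m}
    (hf : DifferentiableAt ℝ f x) :
    dirac (fun y => p.eval (‖y‖ ^ 2) • f y) x =
      p.eval (‖x‖ ^ 2) • dirac f x + (2 * (derivative p).eval (‖x‖ ^ 2)) • (vec x * f x) := by
  have h : HasFDerivAt (fun y => p.eval (‖y‖ ^ 2) • f y) _ x :=
    (hasFDerivAt_eval_norm_sq p x).smul hf.hasFDerivAt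
  rw [dirac_eq h, dirac_eq hf.hasFDerivAt,
    vec_eq_sum, smul_sum, sum_mul, smul_sum, ← sum_add_distrib]
  refine sum_congr rfl fun j _ => ?_
  simp [mul_add, smul_smul, EuclideanSpace.inner_single_right]
  ring_nf

theorem IsHomogeneousPolynomial.differentiable {k : ℕ} {Y : Euc m → Cl m}
    (hY : IsHomogeneousPolynomial k Y) : Differentiable ℝ Y := by
  obtain ⟨c, hc⟩ := hY
  rw [funext hc]
  fun_prop

theorem IsHomogeneousPolynomial.apply_smul {k : ℕ} {Y : Euc m → Cl m}
    (hY : IsHomogeneousPolynomial k Y) (t : ℝ) (x : Euc m) : Y (t • x) = t ^ k • Y x := by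
  obtain ⟨c, hc⟩ := hY
  rw [hc, hc, smul_sum]
  refine sum_congr rfl fun d hd => ?_
  rw [mem_piAntidiag] at hd
  simp only [PiLp.smul_apply, smul_eq_mul, mul_pow, prod_mul_distrib, prod_pow_eq_pow_sum, hd.1,
    mul_smul]

theorem IsHomogeneousPolynomial.euler {k : ℕ} {Y : Euc m → Cl m}
    (hY : IsHomogeneousPolynomial k Y) (x : Euc m) : fderiv ℝ Y x x = (k : ℝ) • Y x := by
  have h1 : HasDerivAt (fun t : ℝ => Y (t • x)) (fderiv ℝ Y x x) 1 := by
    have h : HasDerivAt (fun t : ℝ => t • x) x 1 := by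
      simpa using (hasDerivAt_id (1 : ℝ)).smul_const x
    have hf : HasFDerivAt Y (fderiv ℝ Y x) ((1 : ℝ) • x) := by
      rw [one_smul]
      exact (hY.differentiable x).hasFDerivAt
    exact hf.comp_hasDerivAt (1 : ℝ) h
  have h2 : HasDerivAt (fun t : ℝ => Y (t • x)) ((k : ℝ) • Y x) 1 := by
    simp only [hY.apply_smul]
    simpa using (hasDerivAt_pow k (1 : ℝ)).smul_const (Y x)
  exact h1.unique h2

theorem differentiable_vec_mul {Y : Euc m → Cl m} (hY : Differentiable ℝ Y) :
    Differentiable ℝ fun y => vec y * Y y := fun x =>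
  ((mulCLM m).hasFDerivAt_of_bilinear (vecCLM m).hasFDerivAt
    (hY x).hasFDerivAt).differentiableAt

/-- Moving `e_j` past `x` gives `-x ∂Y - 2 ∑ x_j ∂_j Y - m Y`; the first term vanishes and Euler's
identity evaluates the second. The factor is `-2s`. -/
theorem IsInnerSphericalMonogenic.dirac_vec_mul {k : ℕ} {Y : Euc m → Cl m}
    (hY : IsInnerSphericalMonogenic k Y) (x : Euc m) :
    dirac (fun y => vec y * Y y) x = (-(2 * k + m : ℝ)) • Y x := by
  have hd := (hY.1.differentiable x).hasFDerivAt
  have h : HasFDerivAt (fun y => vec y * Y y) _ x :=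
    (mulCLM m).hasFDerivAt_of_bilinear (vecCLM m).hasFDerivAt hd
  have h0 := hY.2 x
  rw [dirac_eq hd] at h0
  have hE := hY.1.euler x
  have hx : x = ∑ j, x j • EuclideanSpace.single j (1 : ℝ) := by
    ext i
    simp [Pi.single_apply]
  have hE' : ∑ j, x j • fderiv ℝ Y x (EuclideanSpace.single j 1) = (k : ℝ) • Y x := by
    rw [← hE]
    conv_rhs => rw [show fderiv ℝ Y x x = fderiv ℝ Y x (∑ j, x j • EuclideanSpace.single j (1 : ℝ))
      by rw [← hx]]
    simp only [map_sum, map_smul]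
  rw [dirac_eq h]
  have hterm : ∀ j : Fin m, e j * (vec x * fderiv ℝ Y x (EuclideanSpace.single j 1) +
      e j * Y x) = -(vec x * (e j * fderiv ℝ Y x (EuclideanSpace.single j 1))) +
        (-2 : ℝ) • (x j • fderiv ℝ Y x (EuclideanSpace.single j 1)) + (-1 : ℝ) • Y x := fun j => by
    rw [mul_add, ← mul_assoc, ← mul_assoc, e_mul_e, e_mul_vec, add_mul, smul_mul_assoc, one_mul,
      smul_smul, neg_mul, mul_assoc, neg_one_smul, neg_one_mul]
  refine (sum_congr rfl fun j _ => hterm j).trans ?_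
  rw [sum_add_distrib, sum_add_distrib, sum_neg_distrib, ← mul_sum, h0, mul_zero, neg_zero,
    zero_add, ← smul_sum, hE', sum_const, card_univ, Fintype.card_fin, ← Nat.cast_smul_eq_nsmul ℝ,
    smul_smul, smul_smul, ← add_smul]
  congr 1
  ring

/-- The function `p(|x|²) x ^ ε Y`, where `ε ∈ {0, 1}` has the parity of `n`. -/
def radial (Y : Euc m → Cl m) (n : ℕ) (p : ℝ[X]) (x : Euc m) : Cl m :=
  p.eval (‖x‖ ^ 2) • if Even n then Y x else vec x * Y x

theorem dirac_radial {k : ℕ} {Y : Euc m → Cl m} (hY : IsInnerSphericalMonogenic k Y) (n : ℕ)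
    (p : ℝ[X]) : dirac (radial Y n p) =
      radial Y (n + 1) (if Even n then evenStep p else oddStep (k + m / 2) p) := by
  ext x
  by_cases hn : Even n
  · have hn' : ¬ Even (n + 1) := by simpa [Nat.even_add_one] using hn
    have hr : radial Y n p = fun y => p.eval (‖y‖ ^ 2) • Y y := by
      ext y
      simp [radial, hn]
    simp only [hr, hn, if_true]
    rw [dirac_radial_smul p (hY.1.differentiable x), hY.2, smul_zero, zero_add]
    simp [radial, hn', evenStep]
  · have hn' : Even (n + 1) := by simpa [Nat.even_add_one] using hn
    have hr : radial Y n p = fun y => p.eval (‖y‖ ^ 2) • (vec y * Y y) := by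
      ext y
      simp [radial, hn]
    simp only [hr, hn, if_false]
    rw [dirac_radial_smul p (differentiable_vec_mul hY.1.differentiable x), hY.dirac_vec_mul,
      ← mul_assoc, vec_mul_self, ← Algebra.smul_def, smul_smul, smul_smul, ← add_smul]
    simp only [radial, hn', if_true, oddStep, eval_mul, eval_add, eval_C, eval_X]
    congr 1
    ring

/-- Multiplying by the weight makes the successive weights cancel. The statement is for all `a`
because the recursion raises `a`, and for all `x` because both sides get differentiated. -/
theorem one_sub_norm_sq_pow_smul_gegenbauer {k : ℕ} {Y : Euc m → Cl m}
    (hY : IsInnerSphericalMonogenic k Y) (n a : ℕ) (x : Euc m) :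
    (1 - ‖x‖ ^ 2) ^ a • gegenbauer (a : ℝ) n Y x =
      radial Y n (radialIter (k + m / 2) n ((1 - X) ^ (a + n))) x := by
  induction n generalizing a x with
  | zero => simp [gegenbauer, radialIter, radial]
  | succ n ih =>
    have h : (fun y : Euc m => (1 - ‖y‖ ^ 2) ^ ((a : ℝ) + 1) • gegenbauer ((a : ℝ) + 1) n Y y) =
        radial Y n (radialIter (k + m / 2) n ((1 - X) ^ (a + (n + 1)))) := by
      ext y
      have := ih (a + 1) y
      rw [show a + 1 + n = a + (n + 1) by ring] at this
      rw [← this, ← Real.rpow_natCast _ (a + 1)]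
      push_cast
      rfl
    have h' : radialIter ((k : ℝ) + m / 2) (n + 1) ((1 - X) ^ (a + (n + 1))) =
        if Even n then evenStep (radialIter (k + m / 2) n ((1 - X) ^ (a + (n + 1))))
        else oddStep (k + m / 2) (radialIter (k + m / 2) n ((1 - X) ^ (a + (n + 1)))) := rfl
    rw [gegenbauer, gegenbauerOp, h, dirac_radial hY, ← h', smul_smul, Real.rpow_neg_natCast,
      zpow_neg, zpow_natCast]
    -- On the unit sphere with `a > 0` the left side is zero, and divisibility makes the right side
    -- zero too.
    by_cases h0 : (1 - ‖x‖ ^ 2) ^ a = 0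
    · obtain ⟨q, hq⟩ := one_sub_X_pow_dvd_radialIter (k + m / 2) a (n + 1) _ (dvd_refl _)
      rw [h0, zero_mul, zero_smul, radial, hq]
      simp [h0]
    · rw [mul_inv_cancel₀ h0, one_smul]

theorem legendre_eq_radial {k : ℕ} {Y : Euc m → Cl m} (hY : IsInnerSphericalMonogenic k Y)
    (n : ℕ) : legendre n Y = radial Y n (radialIter (k + m / 2) n ((1 - X) ^ n)) := by
  ext x
  simpa [legendre] using one_sub_norm_sq_pow_smul_gegenbauer hY n 0 x

theorem IsHomogeneousPolynomial.exists_ne_zero {k : ℕ} {Y : Euc m → Cl m} (hm : 1 ≤ m)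
    (hY : IsHomogeneousPolynomial k Y) (hY0 : Y ≠ 0) {r : ℝ} (hr : 0 < r) :
    ∃ x, ‖x‖ = r ∧ Y x ≠ 0 := by
  obtain ⟨v, hv⟩ := Function.ne_iff.1 hY0
  have : ∃ v, v ≠ 0 ∧ Y v ≠ 0 := by
    -- By homogeneity, `Y 0 ≠ 0` forces `Y` to be nonzero at every point; a unit vector exists as `m
    -- ≥ 1`.
    by_cases h0 : v = 0
    · refine ⟨EuclideanSpace.single ⟨0, hm⟩ 1, by simp, fun h => hv ?_⟩
      rw [h0, ← zero_smul ℝ (EuclideanSpace.single (⟨0, hm⟩ : Fin m) (1 : ℝ)), hY.apply_smul, h,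
        smul_zero, Pi.zero_apply]
    · exact ⟨v, h0, hv⟩
  obtain ⟨v, h0, hv⟩ := this
  have h0' : ‖v‖ ≠ 0 := norm_ne_zero_iff.2 h0
  refine ⟨(r / ‖v‖) • v, ?_, ?_⟩
  · rw [norm_smul, norm_div, norm_norm, div_mul_cancel₀ _ h0', Real.norm_of_nonneg hr.le]
  · rw [hY.apply_smul]
    exact smul_ne_zero (pow_ne_zero _ (div_ne_zero hr.ne' h0')) hv

end

/-! ### Zeros and vanishing radii of the Clifford–Legendre polynomials. -/

/-- The squares of the radii of `legendre n Y`, in terms of the zeros `x N j` of `jacobi s N` and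
`y N j` of `jacobi (s + 1) N`. -/
def sqRadius (x y : ℕ → ℕ → ℝ) (n : ℕ) : ℕ → ℝ := if Even n then x (n / 2) else y (n / 2)

section

variable {m k : ℕ} {Y : Euc m → Cl m} {x y : ℕ → ℕ → ℝ}

theorem sqRadius_even (x y : ℕ → ℕ → ℝ) (N : ℕ) : sqRadius x y (2 * N) = x N := by
  simp [sqRadius]

theorem sqRadius_odd (x y : ℕ → ℕ → ℝ) (N : ℕ) : sqRadius x y (2 * N + 1) = y N := by
  simp [sqRadius, show (2 * N + 1) / 2 = N by omega]

theorem sqRadius_spec {s : ℝ} (h : ∀ N, InterlacingRoots s N (x N) (y N)) (n : ℕ) :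
    StrictMonoOn (sqRadius x y n) (Set.Iio (n / 2)) ∧
      ∀ j < n / 2, 0 < sqRadius x y n j ∧ sqRadius x y n j < 1 := by
  unfold sqRadius
  split_ifs
  · exact ⟨(h _).strictMonoOn_left, fun j hj =>
      ⟨(h _).pos j hj, ((h _).lt j hj).trans ((h _).lt_one j hj)⟩⟩
  · exact ⟨(h _).strictMonoOn_right, fun j hj => ⟨(h _).pos_right j hj, (h _).lt_one j hj⟩⟩

theorem prod_one_sub_div_eq_zero_iff {r : ℕ → ℝ} {N : ℕ} (hr : ∀ j < N, 0 < r j) (t : ℝ) :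
    ∏ j ∈ range N, (1 - t / r j) = 0 ↔ ∃ j < N, t = r j := by
  simp only [prod_eq_zero_iff, mem_range]
  refine exists_congr fun j => and_congr_right fun hj => ?_
  rw [sub_eq_zero, eq_comm, div_eq_one_iff_eq (hr j hj).ne']

theorem legendre_eq_zero_iff (hm : 1 ≤ m) (hY : IsInnerSphericalMonogenic k Y)
    (h : ∀ N, InterlacingRoots (k + m / 2) N (x N) (y N)) (n : ℕ) (v : Euc m) :
    legendre n Y v = 0 ↔
      (∃ j < n / 2, ‖v‖ ^ 2 = sqRadius x y n j) ∨ Y v = 0 ∨ (Odd n ∧ v = 0) := by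
  have hs : (0 : ℝ) < k + m / 2 := by
    have : (0 : ℝ) < m := by exact_mod_cast hm
    positivity
  rw [legendre_eq_radial hY, radial, smul_eq_zero]
  rcases n.even_or_odd' with ⟨N, rfl | rfl⟩
  · obtain ⟨κ, hκ, he⟩ := radialIter_even hs N
    rw [he, eval_mul, eval_C, mul_eq_zero, or_iff_right hκ, (h N).eval_left,
      prod_one_sub_div_eq_zero_iff (h N).pos, sqRadius_even]
    simp [show ¬ Odd (2 * N) by simp]
  · obtain ⟨κ, hκ, he⟩ := radialIter_odd hs N
    rw [he, eval_mul, eval_C, mul_eq_zero, or_iff_right hκ, (h N).eval_right,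
      prod_one_sub_div_eq_zero_iff (h N).pos_right, sqRadius_odd]
    simp [vec_mul_eq_zero_iff, show (2 * N + 1) / 2 = N by omega, or_comm]

/-- No further radii occur: by homogeneity `Y` vanishes identically on no sphere, so the radial
factor must vanish. -/
theorem mem_vanishingRadii_legendre (hm : 1 ≤ m) (hY : IsInnerSphericalMonogenic k Y)
    (hY0 : Y ≠ 0) (h : ∀ N, InterlacingRoots (k + m / 2) N (x N) (y N)) (n : ℕ) (r : ℝ) :
    r ∈ vanishingRadii (legendre n Y) ↔ ∃ j < n / 2, √(sqRadius x y n j) = r := by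
  constructor
  · rintro ⟨hr, hv⟩
    obtain ⟨v, hvr, hYv⟩ := hY.1.exists_ne_zero hm hY0 hr
    have hv0 : v ≠ 0 := norm_ne_zero_iff.1 (hvr ▸ hr.ne')
    rcases (legendre_eq_zero_iff hm hY h n v).1 (hv v hvr) with ⟨j, hj, hjv⟩ | h1 | h1
    · exact ⟨j, hj, by rw [← hjv, hvr, Real.sqrt_sq hr.le]⟩
    · exact (hYv h1).elim
    · exact (hv0 h1.2).elim
  · rintro ⟨j, hj, rfl⟩
    have hpos := ((sqRadius_spec h n).2 j hj).1
    exact ⟨Real.sqrt_pos.2 hpos, fun v hv => (legendre_eq_zero_iff hm hY h n v).2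
      (Or.inl ⟨j, hj, by rw [hv, Real.sq_sqrt hpos.le]⟩)⟩

end

end CliffordLegendre

end

theorem mainTheorem5 (m : ℕ) (hm : 1 ≤ m) (k : ℕ)
    (Y : CliffordLegendre.Euc m → CliffordLegendre.Cl m)
    (hY : CliffordLegendre.IsInnerSphericalMonogenic k Y) (hY0 : Y ≠ 0) :
    -- the zero set consists of spheres, apart from the zeros of `Y` and, for odd `n`, the origin
    (∀ (n : ℕ) (x : CliffordLegendre.Euc m), CliffordLegendre.legendre n Y x = 0 ↔
      ‖x‖ ∈ CliffordLegendre.vanishingRadii (CliffordLegendre.legendre n Y) ∨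
        Y x = 0 ∨ (Odd n ∧ x = 0)) ∧
    -- `ρ n 0 < ρ n 1 < ⋯ < ρ n (n / 2 - 1)` are the radii of these spheres
    ∃ ρ : ℕ → ℕ → ℝ,
      (∀ n : ℕ, StrictMonoOn (ρ n) (Set.Iio (n / 2)) ∧
        ρ n '' Set.Iio (n / 2) =
          CliffordLegendre.vanishingRadii (CliffordLegendre.legendre n Y) ∧
        ∀ j < n / 2, ρ n j < 1) ∧
      -- indices `2N`, `2N + 1`, `2N + 2`
      (∀ N j : ℕ, j < N →
        ρ (2 * N + 2) j < ρ (2 * N) j ∧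
        ρ (2 * N) j < ρ (2 * N + 1) j ∧
        ρ (2 * N + 1) j < ρ (2 * N + 2) (j + 1)) ∧
      -- indices `2N + 1`, `2N + 2`, `2N + 3`
      (∀ N j : ℕ, j < N →
        ρ (2 * N + 2) j < ρ (2 * N + 3) j ∧
        ρ (2 * N + 3) j < ρ (2 * N + 1) j ∧
        ρ (2 * N + 1) j < ρ (2 * N + 2) (j + 1)) ∧
      (∀ N : ℕ, ρ (2 * N + 2) N < ρ (2 * N + 3) N) := by
  have hs : (0 : ℝ) < k + m / 2 := by
    have : (0 : ℝ) < m := by exact_mod_cast hm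
    positivity
  obtain ⟨x, y, h, hxy⟩ := CliffordLegendre.exists_interlacingRoots hs
  have hmem := CliffordLegendre.mem_vanishingRadii_legendre hm hY hY0 h
  have hspec := CliffordLegendre.sqRadius_spec h
  have hx : ∀ N, CliffordLegendre.sqRadius x y (2 * N) = x N :=
    CliffordLegendre.sqRadius_even x y
  have hx' : ∀ N, CliffordLegendre.sqRadius x y (2 * N + 2) = x (N + 1) := fun N => hx (N + 1)
  have hy : ∀ N, CliffordLegendre.sqRadius x y (2 * N + 1) = y N :=
    CliffordLegendre.sqRadius_odd x y
  have hy' : ∀ N, CliffordLegendre.sqRadius x y (2 * N + 3) = y (N + 1) := fun N => hy (N + 1)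
  have hsq : ∀ {a b : ℝ}, 0 < a → a < b → √a < √b := fun ha hab =>
    Real.sqrt_lt_sqrt ha.le hab
  refine ⟨fun n v => ?_, fun n j => √(CliffordLegendre.sqRadius x y n j), fun n => ⟨?_, ?_, ?_⟩,
    fun N j hj => ?_, fun N j hj => ?_, fun N => ?_⟩
  · rw [CliffordLegendre.legendre_eq_zero_iff hm hY h, hmem]
    refine or_congr_left (exists_congr fun j => and_congr_right fun hj => ?_)
    rw [Real.sqrt_eq_iff_eq_sq ((hspec n).2 j hj).1.le (norm_nonneg v), eq_comm]
  · exact fun i hi j hj hij => hsq ((hspec n).2 i hi).1 ((hspec n).1 hi hj hij)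
  · ext r
    rw [hmem]
    rfl
  · intro j hj
    rw [Real.sqrt_lt' one_pos, one_pow]
    exact ((hspec n).2 j hj).2
  · obtain ⟨h1, h2, h3⟩ := hxy N j hj
    simp only [hx, hx', hy]
    exact ⟨hsq ((h (N + 1)).pos j (by omega)) h1, hsq ((h N).pos j hj) ((h N).lt j hj),
      hsq ((h N).pos_right j hj) h3⟩
  · obtain ⟨h1, h2, h3⟩ := hxy N j hj
    simp only [hx', hy, hy']
    exact ⟨hsq ((h (N + 1)).pos j (by omega)) ((h (N + 1)).lt j (by omega)),
      hsq ((h (N + 1)).pos_right j (by omega)) h2, hsq ((h N).pos_right j hj) h3⟩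
  -- The last pair, `j = N`, has no counterpart at stage `N`; only the interlacing within stage `N +
  -- 1` is used.
  · simp only [hx', hy']
    exact hsq ((h (N + 1)).pos N (by omega)) ((h (N + 1)).lt N (by omega))
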